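/- For a totally ordered abelian group $G$ let $\Delta(G)$ be the MV-algebra $\Gamma(\mathbb Z\times_{\mathrm{lex}}G,(1,0))$, i.e. the interval $[(0,0),(1,0)]$ of the lexicographic product $\mathbb Z\times_{\mathrm{lex}}G$ with $0:=(0,0)$, $1:=(1,0)$, $x\oplus y=\min(x+y,(1,0))$ and $\neg x=(1,0)-x$. Let $\mathrm{Perf}^{\mathbb Q}$ be the class of all structures for the language $\{\oplus,\neg,0,1\}$ of MV-algebras that are isomorphic to $\Delta(G)$ for some subgroup $G$ of $\mathbb Q$ with the induced order (the trivial subgroup included). A geometric formula in finitely many variables is one built from atomic formulas (including equations) by finite conjunctions (including the empty one $\top$), disjunctions of arbitrary set-indexed families (including the empty one $\bot$), and existential quantification. A geometric theory is a set of axioms of the form $\forall x_1\cdots\forall x_n\,(\varphi\to\psi)$ with $\varphi,\psi$ geometric formulas in the variables $x_1,\dots,x_n$. Theorem. The class $\mathrm{Perf}^{\mathbb Q}$ is geometric in the language of MV-algebras: there is a geometric theory $T$ in this language such that a structure $M$ for the language is a model of $T$ if and only if $M\in\mathrm{Perf}^{\mathbb Q}$. -/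

import Mathlib

section GeometricLogic

universe u v w x

/-- Geometric formulas over the (one-sorted) first-order language `L` in the finite context of
variables `x₀, …, xₙ₋₁`: they are built from equalities and atomic relations by finite
conjunctions, disjunctions of arbitrary set-indexed families, and existential quantification.
(The formula `⊥` is the empty disjunction.) -/
inductive GeomFormula (L : FirstOrder.Language.{u, v}) : ℕ → Type (max u v (w + 1)) where
  | equal {n : ℕ} (s t : L.Term (Fin n)) : GeomFormula L n
  | rel {n k : ℕ} (R : L.Relations k) (ts : Fin k → L.Term (Fin n)) : GeomFormula L n
  | verum {n : ℕ} : GeomFormula L n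
  | and {n : ℕ} (φ ψ : GeomFormula L n) : GeomFormula L n
  | iOr {n : ℕ} {ι : Type w} (φ : ι → GeomFormula L n) : GeomFormula L n
  | ex {n : ℕ} (φ : GeomFormula L (n + 1)) : GeomFormula L n

/-- Satisfaction of a geometric formula in an `L`-structure under an assignment. -/
def GeomFormula.Realize {L : FirstOrder.Language.{u, v}} {M : Type x} [L.Structure M] :
    {n : ℕ} → GeomFormula.{u, v, w} L n → (Fin n → M) → Prop
  | _, .equal s t, a => s.realize a = t.realize a
  | _, .rel R ts, a => FirstOrder.Language.Structure.RelMap R (fun i => (ts i).realize a)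
  | _, .verum, _ => True
  | _, .and φ ψ, a => φ.Realize a ∧ ψ.Realize a
  | _, .iOr φ, a => ∃ i, (φ i).Realize a
  | _, .ex φ, a => ∃ b : M, φ.Realize (Fin.snoc a b)

/-- A geometric sequent `φ ⊢ ψ` in the context `x₀, …, xₙ₋₁`, where `n = arity`. -/
structure GeomSequent (L : FirstOrder.Language.{u, v}) where
  arity : ℕ
  hyp : GeomFormula.{u, v, w} L arity
  concl : GeomFormula.{u, v, w} L arity

/-- A structure satisfies `φ ⊢ ψ` if `∀ x₀ … xₙ₋₁, φ → ψ` holds in it. -/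
def GeomSequent.Holds {L : FirstOrder.Language.{u, v}} (σ : GeomSequent.{u, v, w} L)
    (M : Type x) [L.Structure M] : Prop :=
  ∀ a : Fin σ.arity → M, σ.hyp.Realize a → σ.concl.Realize a

/-- A geometric theory: a set-indexed family of geometric sequents, its axioms. -/
structure GeomTheory (L : FirstOrder.Language.{u, v}) where
  Index : Type w
  ax : Index → GeomSequent.{u, v, w} L

/-- `M` is a (set-valued) model of the geometric theory `T`. -/
def GeomTheory.IsModel {L : FirstOrder.Language.{u, v}} (T : GeomTheory.{u, v, w} L)
    (M : Type x) [L.Structure M] : Prop :=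
  ∀ i : T.Index, (T.ax i).Holds M

/-- A class of `L`-structures is geometric if it is the class of models of a geometric theory. -/
def IsGeometricClass (L : FirstOrder.Language.{u, v}) (K : (M : Type x) → [L.Structure M] → Prop) : Prop :=
  ∃ T : GeomTheory.{u, v, w} L, ∀ (M : Type x) [L.Structure M], T.IsModel M ↔ K M

end GeometricLogic

/-- MV-algebras `(A, ⊕, ¬, 0, 1)`. -/
class MVAlgebra (A : Type*) where
  oplus : A → A → A
  neg : A → A
  zero : A
  one : A
  oplus_assoc : ∀ x y z, oplus (oplus x y) z = oplus x (oplus y z)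
  oplus_comm : ∀ x y, oplus x y = oplus y x
  oplus_zero : ∀ x, oplus x zero = x
  neg_zero : neg zero = one
  oplus_one : ∀ x, oplus x one = one
  neg_neg : ∀ x, neg (neg x) = x
  lukasiewicz : ∀ x y, oplus (neg (oplus (neg x) y)) y = oplus (neg (oplus (neg y) x)) x

/-- The function symbols `0`, `1`, `¬`, `⊕` of the language of MV-algebras. -/
inductive MVFunc : ℕ → Type
  | zero : MVFunc 0
  | one : MVFunc 0
  | neg : MVFunc 1
  | oplus : MVFunc 2

/-- The first-order language of MV-algebras (equality is logical; no relation symbols). -/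
def mvLanguage : FirstOrder.Language.{0, 0} where
  Functions := MVFunc
  Relations := fun _ => Empty

/-- Every MV-algebra is a structure for the language of MV-algebras. -/
instance MVAlgebra.instStructure (A : Type*) [MVAlgebra A] : mvLanguage.Structure A where
  funMap {_} f a :=
    match f, a with
    | MVFunc.zero, _ => MVAlgebra.zero
    | MVFunc.one, _ => MVAlgebra.one
    | MVFunc.neg, a => MVAlgebra.neg (a 0)
    | MVFunc.oplus, a => MVAlgebra.oplus (a 0) (a 1)
  RelMap {_} r _ := nomatch r

/-- The carrier `[0, u]` of Mundici's `Γ(H, u)`. -/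
abbrev MVGamma {H : Type*} [AddCommGroup H] [Lattice H] (u : H) : Type _ := Set.Icc (0 : H) u

/-- Mundici's MV-algebra `Γ(H, u)`: the interval `[0, u]` of an abelian `ℓ`-group `H` with
`x ⊕ y = (x + y) ⊓ u`, `¬ x = u - x`. -/
abbrev MVGamma.mvAlgebra {H : Type*} [AddCommGroup H] [Lattice H] [IsOrderedAddMonoid H] {u : H}
    (hu : 0 ≤ u) : MVAlgebra (MVGamma u) where
  oplus x y := ⟨(x.1 + y.1) ⊓ u, le_inf (add_nonneg x.2.1 y.2.1) hu, inf_le_right⟩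
  neg x := ⟨u - x.1, sub_nonneg.2 x.2.2, sub_le_self u x.2.1⟩
  zero := ⟨0, le_rfl, hu⟩
  one := ⟨u, hu, le_rfl⟩
  oplus_assoc x y z := by
    apply Subtype.ext
    change ((x.1 + y.1) ⊓ u + z.1) ⊓ u = (x.1 + (y.1 + z.1) ⊓ u) ⊓ u
    rw [inf_add, add_inf, inf_assoc, inf_assoc, inf_eq_right.2 (le_add_of_nonneg_right z.2.1),
      inf_eq_right.2 (le_add_of_nonneg_left x.2.1), add_assoc]
  oplus_comm x y := by
    apply Subtype.ext
    change (x.1 + y.1) ⊓ u = (y.1 + x.1) ⊓ u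
    rw [add_comm]
  oplus_zero x := by
    apply Subtype.ext
    change (x.1 + 0) ⊓ u = x.1
    rw [add_zero, inf_eq_left.2 x.2.2]
  neg_zero := by
    apply Subtype.ext
    change u - 0 = u
    rw [sub_zero]
  oplus_one x := by
    apply Subtype.ext
    change (x.1 + u) ⊓ u = u
    exact inf_eq_right.2 (le_add_of_nonneg_left x.2.1)
  neg_neg x := by
    apply Subtype.ext
    change u - (u - x.1) = x.1
    rw [sub_sub_cancel]
  lukasiewicz x y := by
    have key : ∀ a b : H, u - (u - a + b) ⊓ u + b = a ⊔ b := by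
      intro a b
      rw [sub_eq_add_neg, neg_inf, add_sup, sup_add]
      congr 1 <;> abel
    apply Subtype.ext
    change (u - (u - x.1 + y.1) ⊓ u + y.1) ⊓ u = (u - (u - y.1 + x.1) ⊓ u + x.1) ⊓ u
    rw [key, key, sup_comm]

/-- The carrier of `Δ(G) = Γ(ℤ ×ₗₑₓ G, (1, 0))`. -/
abbrev MVDelta (G : Type*) [AddCommGroup G] [LinearOrder G] : Type _ :=
  MVGamma (H := ℤ ×ₗ G) (toLex (1, 0))

/-- The MV-algebra `Δ(G) = Γ(ℤ ×ₗₑₓ G, (1, 0))` of a totally ordered abelian group `G`. -/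
instance MVDelta.instMVAlgebra (G : Type*) [AddCommGroup G] [LinearOrder G]
    [IsOrderedAddMonoid G] : MVAlgebra (MVDelta G) :=
  MVGamma.mvAlgebra (Prod.Lex.toLex_le_toLex.2 (Or.inl Int.zero_lt_one))

/-- `Perf^ℚ`: the structures isomorphic to the MV-algebra `Δ(G)` for some subgroup `G` of `ℚ`
with the induced order (the trivial subgroup is allowed). -/
def IsPerfQ (M : Type*) [mvLanguage.Structure M] : Prop :=
  ∃ G : AddSubgroup ℚ, Nonempty (FirstOrder.Language.Equiv mvLanguage M (MVDelta G))

universe u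

/-!
A perfect MV-algebra consists of its infinitesimals and their negations. The infinitesimals form a
cancellative monoid under `⊕`, the radical, in which `0` is the only unit; when divisibility
totally orders the radical, it determines the whole algebra. The radical of `Δ(G)` is the positive
cone of `G`, so everything reduces to recognising the positive cones of subgroups of `ℚ` among
cancellative monoids without nontrivial units. They are the locally cyclic ones, those in which
any two elements are natural multiples of a common element: such a monoid embeds in `ℚ≥0` by the
ratio of its elements to a fixed `e ≠ 0`, and conversely Bézout's identity gives a common divisor
of two positive elements of a subgroup of `ℚ`. Local cyclicity is the geometric sequent
`x, y infinitesimal ⊢ ∃ z infinitesimal, ⋁_{(m, n) ∈ ℕ × ℕ} (x = m z ∧ y = n z)`, and the axioms of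
perfect MV-algebras are geometric as well.
-/

open FirstOrder

section Transport

universe v₁ v₂ w x y

variable {L : FirstOrder.Language.{v₁, v₂}} {M : Type x} {N : Type y}
  [L.Structure M] [L.Structure N]

theorem GeomFormula.realize_equiv (e : L.Equiv M N) {n : ℕ} (φ : GeomFormula.{v₁, v₂, w} L n)
    (a : Fin n → M) : φ.Realize (e ∘ a) ↔ φ.Realize a := by
  induction φ with
  | equal s t =>
    simp only [GeomFormula.Realize, Language.HomClass.realize_term]
    exact e.injective.eq_iff
  | rel R ts =>
    simp only [GeomFormula.Realize, Language.HomClass.realize_term]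
    exact e.map_rel R _
  | verum => simp only [GeomFormula.Realize]
  | and φ ψ hφ hψ => simp only [GeomFormula.Realize, hφ, hψ]
  | iOr φ h => simp only [GeomFormula.Realize, h]
  | ex φ h =>
    simp only [GeomFormula.Realize]
    refine e.surjective.exists.trans (exists_congr fun b => ?_)
    rw [← h, Fin.comp_snoc]

theorem GeomSequent.Holds.of_equiv (e : L.Equiv M N) {σ : GeomSequent.{v₁, v₂, w} L}
    (h : σ.Holds N) : σ.Holds M := fun a ha =>
  (σ.concl.realize_equiv e a).1 (h _ ((σ.hyp.realize_equiv e a).2 ha))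

theorem GeomTheory.IsModel.of_equiv (e : L.Equiv M N) {T : GeomTheory.{v₁, v₂, w} L}
    (h : T.IsModel N) : T.IsModel M := fun i => (h i).of_equiv e

end Transport

/-- An additive monoid is locally cyclic if any two of its elements are natural multiples of a
common element. -/
def IsLocallyCyclic (R : Type*) [AddMonoid R] : Prop :=
  ∀ x y : R, ∃ (z : R) (m n : ℕ), x = m • z ∧ y = n • z

namespace IsLocallyCyclic

variable {R : Type*} [AddMonoid R]

theorem of_surjective {S F : Type*} [AddMonoid S] [FunLike F R S] [AddMonoidHomClass F R S]
    (hR : IsLocallyCyclic R) (f : F) (hf : Function.Surjective f) :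
    IsLocallyCyclic S := by
  intro x y
  obtain ⟨x, rfl⟩ := hf x
  obtain ⟨y, rfl⟩ := hf y
  obtain ⟨z, m, n, rfl, rfl⟩ := hR x y
  exact ⟨f z, m, n, map_nsmul f m z, map_nsmul f n z⟩

theorem exists_eq_add_or (hR : IsLocallyCyclic R) (x y : R) : ∃ z, x = y + z ∨ y = x + z := by
  obtain ⟨z, m, n, rfl, rfl⟩ := hR x y
  rcases le_total n m with h | h
  · exact ⟨(m - n) • z, .inl (by rw [← add_nsmul, Nat.add_sub_cancel' h])⟩
  · exact ⟨(n - m) • z, .inr (by rw [← add_nsmul, Nat.add_sub_cancel' h])⟩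

end IsLocallyCyclic

theorem isLocallyCyclic_nnrat : IsLocallyCyclic ℚ≥0 := by
  intro x y
  refine ⟨1 / (x.den * y.den), x.num * y.den, y.num * x.den, ?_, ?_⟩
  · conv_lhs => rw [← x.num_div_den]
    simp only [nsmul_eq_mul, Nat.cast_mul]
    field_simp
  · conv_lhs => rw [← y.num_div_den]
    simp only [nsmul_eq_mul, Nat.cast_mul]
    field_simp

theorem gcd_nsmul_mem {H : Type*} [AddGroup H] {G : AddSubgroup H} {h : H} {m n : ℕ}
    (hm : m • h ∈ G) (hn : n • h ∈ G) : m.gcd n • h ∈ G := by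
  have bezout : m.gcd n • h = m.gcdA n • m • h + m.gcdB n • n • h := by
    simp only [← natCast_zsmul, ← mul_zsmul', ← add_zsmul, Nat.gcd_eq_gcd_ab]
  rw [bezout]
  exact add_mem (zsmul_mem hm _) (zsmul_mem hn _)

theorem isLocallyCyclic_nonneg_addSubgroup_rat (G : AddSubgroup ℚ) :
    IsLocallyCyclic {g : G // 0 ≤ g} := by
  rintro ⟨⟨x, hxG⟩, hx⟩ ⟨⟨y, hyG⟩, hy⟩
  obtain ⟨⟨w, hw⟩, m, n, hm, hn⟩ := isLocallyCyclic_nnrat ⟨x, hx⟩ ⟨y, hy⟩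
  obtain rfl : x = m • w := congrArg NNRat.cast hm
  obtain rfl : y = n • w := congrArg NNRat.cast hn
  obtain ⟨a, ha⟩ := m.gcd_dvd_left n
  obtain ⟨b, hb⟩ := m.gcd_dvd_right n
  refine ⟨⟨⟨m.gcd n • w, gcd_nsmul_mem hxG hyG⟩, nsmul_nonneg hw _⟩, a, b, ?_, ?_⟩
  · ext
    change m • w = a • m.gcd n • w
    rw [← mul_nsmul, ← ha]
  · ext
    change n • w = b • m.gcd n • w
    rw [← mul_nsmul, ← hb]

theorem div_eq_div_of_nsmul_eq {R : Type*} [AddMonoid R] {e x : R}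
    (he : Function.Injective fun k : ℕ => k • e) {m n m' n' : ℕ} (hn : n ≠ 0) (hn' : n' ≠ 0)
    (h : n • x = m • e) (h' : n' • x = m' • e) : (m / n : ℚ≥0) = m' / n' := by
  have cross : m * n' = m' * n := he <| calc
    (m * n') • e = n' • n • x := by rw [h, mul_nsmul]
    _ = n • n' • x := nsmul_left_comm x n n'
    _ = (m' * n) • e := by rw [h', mul_nsmul]
  rw [div_eq_div_iff (Nat.cast_ne_zero.2 hn) (Nat.cast_ne_zero.2 hn')]
  exact_mod_cast cross

theorem exists_addMonoidHom_nnrat {R : Type*} [AddCommMonoid R] {e : R}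
    (he : Function.Injective fun k : ℕ => k • e) (hR : ∀ x : R, ∃ m n : ℕ, n ≠ 0 ∧ n • x = m • e) :
    ∃ f : R →+ ℚ≥0, ∀ (x : R) (m n : ℕ), n ≠ 0 → n • x = m • e → f x = m / n := by
  choose num den den_ne_zero den_nsmul using hR
  have ratio_eq {x : R} {m n : ℕ} (hn : n ≠ 0) (h : n • x = m • e) :
      (num x / den x : ℚ≥0) = m / n :=
    div_eq_div_of_nsmul_eq he (den_ne_zero x) hn (den_nsmul x) h
  refine ⟨⟨⟨fun x => num x / den x, ?_⟩, fun x y => ?_⟩, fun x m n => ratio_eq⟩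
  · simpa using ratio_eq (x := 0) (m := 0) one_ne_zero (by simp)
  · have add_nsmul_eq :
        (den x * den y) • (x + y) = (num x * den y + den x * num y) • e := by
      rw [nsmul_add, add_nsmul, mul_nsmul, den_nsmul, mul_nsmul', den_nsmul, mul_nsmul, mul_nsmul']
    dsimp only
    rw [ratio_eq (mul_ne_zero (den_ne_zero x) (den_ne_zero y)) add_nsmul_eq,
      div_add_div _ _ (Nat.cast_ne_zero.2 (den_ne_zero x)) (Nat.cast_ne_zero.2 (den_ne_zero y))]
    simp only [Nat.cast_add, Nat.cast_mul]

theorem injective_nsmul_of_ne_zero {R : Type*} [AddCancelCommMonoid R] [Subsingleton (AddUnits R)]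
    {x : R} (hx : x ≠ 0) : Function.Injective fun k : ℕ => k • x := by
  rw [injective_nsmul_iff_not_isOfFinAddOrder, isOfFinAddOrder_iff_nsmul_eq_zero]
  rintro ⟨n, hn, h⟩
  exact hx (isAddUnit_iff_eq_zero.1 ((isAddUnit_nsmul_iff hn.ne').1 (h ▸ isAddUnit_zero)))

theorem exists_addEquiv_nonneg_of_injective {R H : Type*} [AddMonoid R] [AddCommGroup H]
    [LinearOrder H] [IsOrderedAddMonoid H] (hR : ∀ x y : R, ∃ z, x = y + z ∨ y = x + z)
    (f : R →+ H) (hf : Function.Injective f) (f_nonneg : ∀ x, 0 ≤ f x) :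
    ∃ G : AddSubgroup H, Nonempty (R ≃+ {g : G // 0 ≤ g}) := by
  let G : AddSubgroup H :=
    { carrier := {h | ∃ x y, h = f x - f y}
      zero_mem' := ⟨0, 0, (sub_self _).symm⟩
      add_mem' := by
        rintro _ _ ⟨x, y, rfl⟩ ⟨x', y', rfl⟩
        exact ⟨x + x', y + y', by rw [map_add, map_add, add_sub_add_comm]⟩
      neg_mem' := by
        rintro _ ⟨x, y, rfl⟩
        exact ⟨y, x, neg_sub _ _⟩ }
  have f_mem (x : R) : f x ∈ G := ⟨x, 0, by rw [map_zero, sub_zero]⟩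
  have exists_of_nonneg : ∀ h ∈ G, 0 ≤ h → ∃ x, f x = h := by
    rintro _ ⟨x, y, rfl⟩ h
    obtain ⟨z, rfl | rfl⟩ := hR x y
    · exact ⟨z, by rw [map_add, add_sub_cancel_left]⟩
    · rw [map_add, sub_add_cancel_left] at h ⊢
      have : f z = 0 := le_antisymm (neg_nonneg.1 h) (f_nonneg z)
      exact ⟨0, by rw [this, map_zero, neg_zero]⟩
  let F : R →+ {g : G // 0 ≤ g} :=
    { toFun x := ⟨⟨f x, f_mem x⟩, f_nonneg x⟩
      map_zero' := by ext; exact map_zero f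
      map_add' x y := by ext; exact map_add f x y }
  refine ⟨G, ⟨AddEquiv.ofBijective F ⟨fun x y h => hf ?_, fun ⟨⟨h, hG⟩, h0⟩ => ?_⟩⟩⟩
  · exact congrArg (fun g => (g.1 : H)) h
  · obtain ⟨x, rfl⟩ := exists_of_nonneg h hG h0
    exact ⟨x, rfl⟩

namespace IsLocallyCyclic

variable {R : Type*} [AddCancelCommMonoid R] [Subsingleton (AddUnits R)]

theorem exists_injective_addMonoidHom_nnrat (hR : IsLocallyCyclic R) :
    ∃ f : R →+ ℚ≥0, Function.Injective f := by
  rcases subsingleton_or_nontrivial R with _ | _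
  · exact ⟨0, Function.injective_of_subsingleton _⟩
  obtain ⟨e, he⟩ := exists_ne (0 : R)
  have commensurable (x : R) : ∃ m n : ℕ, n ≠ 0 ∧ n • x = m • e := by
    obtain ⟨z, m, n, rfl, hn⟩ := hR x e
    refine ⟨m, n, ?_, by rw [hn, nsmul_left_comm]⟩
    rintro rfl
    exact he (by rw [hn, zero_nsmul])
  obtain ⟨f, hf⟩ := exists_addMonoidHom_nnrat (injective_nsmul_of_ne_zero he) commensurable
  have f_ne_zero {x : R} (hx : x ≠ 0) : f x ≠ 0 := by
    obtain ⟨m, n, hn, h⟩ := commensurable x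
    rw [hf x m n hn h, div_ne_zero_iff, Nat.cast_ne_zero, Nat.cast_ne_zero]
    refine ⟨?_, hn⟩
    rintro rfl
    exact hn (injective_nsmul_of_ne_zero hx (by simpa using h))
  refine ⟨f, fun x y h => ?_⟩
  obtain ⟨z, m, n, rfl, rfl⟩ := hR x y
  rcases eq_or_ne z 0 with rfl | hz
  · simp only [nsmul_zero]
  · rw [map_nsmul, map_nsmul, nsmul_eq_mul, nsmul_eq_mul] at h
    rw [Nat.cast_injective (mul_right_cancel₀ (f_ne_zero hz) h)]

theorem exists_addEquiv_nonneg_addSubgroup_rat (hR : IsLocallyCyclic R) :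
    ∃ G : AddSubgroup ℚ, Nonempty (R ≃+ {g : G // 0 ≤ g}) := by
  obtain ⟨f, hf⟩ := hR.exists_injective_addMonoidHom_nnrat
  exact exists_addEquiv_nonneg_of_injective hR.exists_eq_add_or
    (NNRat.coeHom.toAddMonoidHom.comp f) (NNRat.cast_injective.comp hf) fun x => (f x).2

end IsLocallyCyclic

namespace MVAlgebra

local infixl:65 "⊕ₘ" => MVAlgebra.oplus
local prefix:max "¬ₘ" => MVAlgebra.neg

section Basic

variable {A : Type*} [MVAlgebra A]

theorem neg_one : ¬ₘ(one : A) = zero := by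
  rw [← neg_zero, neg_neg]

theorem zero_oplus (x : A) : zero ⊕ₘ x = x := by
  rw [oplus_comm, oplus_zero]

theorem one_oplus (x : A) : one ⊕ₘ x = one := by
  rw [oplus_comm, oplus_one]

theorem neg_oplus_self (x : A) : ¬ₘx ⊕ₘ x = one := by
  simpa only [oplus_one, neg_one, zero_oplus] using (lukasiewicz x one).symm

theorem neg_oplus_self_oplus (x y : A) : ¬ₘx ⊕ₘ (x ⊕ₘ y) = one := by
  rw [← oplus_assoc, neg_oplus_self, one_oplus]

theorem exists_neg_eq_neg_oplus_oplus (x y : A) : ∃ z, ¬ₘx = ¬ₘ(x ⊕ₘ y) ⊕ₘ z := by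
  refine ⟨¬ₘ(x ⊕ₘ ¬ₘ(x ⊕ₘ y)), ?_⟩
  have h := lukasiewicz (¬ₘx) ¬ₘ(x ⊕ₘ y)
  rw [neg_neg, neg_neg, oplus_comm (x ⊕ₘ y), neg_oplus_self_oplus, neg_one, zero_oplus] at h
  rw [← h, oplus_comm]

/-- `x` is infinitesimal if `¬x ⊕ ¬x = 1`, that is, `x ≤ ¬x` in the natural order. In
perfect MV-algebras this is equivalent to the usual condition that `n • x ≤ ¬x` for all `n`. -/
def IsInfinitesimal (x : A) : Prop :=
  ¬ₘx ⊕ₘ ¬ₘx = one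

theorem isInfinitesimal_zero : IsInfinitesimal (zero : A) := by
  rw [IsInfinitesimal, neg_zero, oplus_one]

theorem IsInfinitesimal.neg_oplus_neg {x y : A} (h : IsInfinitesimal (x ⊕ₘ y)) :
    ¬ₘx ⊕ₘ ¬ₘy = one := by
  obtain ⟨a, ha⟩ := exists_neg_eq_neg_oplus_oplus x y
  obtain ⟨b, hb⟩ := exists_neg_eq_neg_oplus_oplus y x
  rw [ha, hb, oplus_comm y, oplus_assoc, oplus_comm a, oplus_assoc, ← oplus_assoc, h, one_oplus]

theorem neg_oplus_oplus_of_neg_oplus_neg {x y : A} (h : ¬ₘx ⊕ₘ ¬ₘy = one) :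
    ¬ₘ(x ⊕ₘ y) ⊕ₘ y = ¬ₘx := by
  have := lukasiewicz (¬ₘx) y
  rwa [neg_neg, oplus_comm (¬ₘy), h, neg_one, zero_oplus] at this

end Basic

/-- Perfect MV-algebras: the infinitesimals form an ideal, and of `x` and `¬x` exactly one is
infinitesimal. -/
class IsPerfect (A : Type*) [MVAlgebra A] : Prop where
  zero_ne_one : (zero : A) ≠ one
  isInfinitesimal_or_neg (x : A) : IsInfinitesimal x ∨ IsInfinitesimal ¬ₘx
  isInfinitesimal_oplus {x y : A} :
    IsInfinitesimal x → IsInfinitesimal y → IsInfinitesimal (x ⊕ₘ y)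

/-- The radical of a perfect MV-algebra, the set of its infinitesimals, regarded as an additive
monoid under `⊕`. -/
def Radical (A : Type*) [MVAlgebra A] : Type _ :=
  {x : A // IsInfinitesimal x}

section Radical

variable {A : Type*} [MVAlgebra A]

namespace Radical

instance : CoeOut (Radical A) A := ⟨Subtype.val⟩

@[ext] theorem ext {x y : Radical A} (h : (x : A) = y) : x = y := Subtype.ext h

theorem neg_injective : Function.Injective fun x : Radical A => ¬ₘ(x : A) := fun x y h =>
  ext (by rw [← neg_neg (x : A), ← neg_neg (y : A)]; exact congrArg _ h)

instance : Zero (Radical A) := ⟨⟨zero, isInfinitesimal_zero⟩⟩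

theorem coe_zero : ((0 : Radical A) : A) = zero := rfl

variable [IsPerfect A]

instance : Add (Radical A) := ⟨fun x y => ⟨x.1 ⊕ₘ y.1, IsPerfect.isInfinitesimal_oplus x.2 y.2⟩⟩

instance : AddCommMonoid (Radical A) where
  add_assoc x y z := ext (oplus_assoc _ _ _)
  add_comm x y := ext (oplus_comm _ _)
  zero_add x := ext (zero_oplus _)
  add_zero x := ext (oplus_zero _)
  nsmul := nsmulRec

theorem coe_add (x y : Radical A) : ((x + y : Radical A) : A) = x.1 ⊕ₘ y.1 := rfl

theorem neg_oplus_neg (x y : Radical A) : ¬ₘ(x : A) ⊕ₘ ¬ₘ(y : A) = one :=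
  (x + y).2.neg_oplus_neg

theorem neg_add_oplus (x y : Radical A) : ¬ₘ((x + y : Radical A) : A) ⊕ₘ y = ¬ₘ(x : A) :=
  neg_oplus_oplus_of_neg_oplus_neg (neg_oplus_neg x y)

instance : AddCancelCommMonoid (Radical A) where
  add_left_cancel x y z h := by
    apply neg_injective
    dsimp only at h ⊢
    rw [← neg_add_oplus y x, ← neg_add_oplus z x, add_comm y, add_comm z, h]

theorem eq_zero_of_add_eq_zero {x y : Radical A} (h : x + y = 0) : x = 0 := by
  apply neg_injective
  dsimp only
  rw [← neg_add_oplus x y, h, coe_zero, neg_zero, one_oplus]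

instance : Subsingleton (AddUnits (Radical A)) where
  allEq x y := AddUnits.ext <|
    (eq_zero_of_add_eq_zero x.val_neg).trans (eq_zero_of_add_eq_zero y.val_neg).symm

theorem not_isInfinitesimal_neg (x : Radical A) : ¬ IsInfinitesimal ¬ₘ(x : A) := by
  intro h
  have add_self_eq_one : (x : A) ⊕ₘ x = one := by simpa only [IsInfinitesimal, neg_neg] using h
  have one_infinitesimal : IsInfinitesimal (one : A) := add_self_eq_one ▸ (x + x).2
  rw [IsInfinitesimal, neg_one, oplus_zero] at one_infinitesimal
  exact IsPerfect.zero_ne_one one_infinitesimal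

theorem exists_eq_or_eq_neg (x : A) : ∃ r : Radical A, x = r ∨ x = ¬ₘ(r : A) := by
  rcases IsPerfect.isInfinitesimal_or_neg x with h | h
  · exact ⟨⟨x, h⟩, .inl rfl⟩
  · exact ⟨⟨¬ₘx, h⟩, .inr (neg_neg x).symm⟩

end Radical

section Extend

variable {B : Type*} [MVAlgebra B] [IsPerfect A]

open Classical in
/-- The extension of a map between radicals to perfect MV-algebras that commutes with `¬`. -/
noncomputable def radicalExtend (f : Radical A → Radical B) (x : A) : B :=
  if h : IsInfinitesimal x then f ⟨x, h⟩
  else ¬ₘ(f ⟨¬ₘx, (IsPerfect.isInfinitesimal_or_neg x).resolve_left h⟩ : B)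

theorem radicalExtend_coe (f : Radical A → Radical B) (r : Radical A) :
    radicalExtend f (r : A) = f r :=
  dif_pos r.2

theorem radicalExtend_neg_coe (f : Radical A → Radical B) (r : Radical A) :
    radicalExtend f ¬ₘ(r : A) = ¬ₘ(f r : B) := by
  rw [radicalExtend, dif_neg r.not_isInfinitesimal_neg]
  simp only [neg_neg]
  rfl

theorem radicalExtend_neg (f : Radical A → Radical B) (x : A) :
    radicalExtend f ¬ₘx = ¬ₘ(radicalExtend f x) := by
  obtain ⟨r, rfl | rfl⟩ := Radical.exists_eq_or_eq_neg x
  · rw [radicalExtend_neg_coe, radicalExtend_coe]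
  · rw [neg_neg, radicalExtend_neg_coe, radicalExtend_coe, neg_neg]

variable [IsPerfect B]

theorem leftInverse_radicalExtend {f : Radical A → Radical B} {g : Radical B → Radical A}
    (h : Function.LeftInverse g f) :
    Function.LeftInverse (radicalExtend g) (radicalExtend f) := by
  intro x
  obtain ⟨r, rfl | rfl⟩ := Radical.exists_eq_or_eq_neg x
  · rw [radicalExtend_coe, radicalExtend_coe, h]
  · rw [radicalExtend_neg_coe, radicalExtend_neg_coe, h]

theorem radicalExtend_zero (f : Radical A →+ Radical B) : radicalExtend f zero = zero := by
  rw [← Radical.coe_zero, radicalExtend_coe, map_zero, Radical.coe_zero]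

theorem radicalExtend_one (f : Radical A →+ Radical B) : radicalExtend f one = one := by
  rw [← neg_zero, radicalExtend_neg, radicalExtend_zero, neg_zero]

-- In the order of the radical, `¬r ⊕ s` is `1` if `r ≤ s` and `¬(r - s)` if `s ≤ r`.
theorem radicalExtend_neg_oplus (f : Radical A →+ Radical B) {r s : Radical A}
    (h : ∃ t, r = s + t ∨ s = r + t) :
    radicalExtend f (¬ₘ(r : A) ⊕ₘ (s : A)) = ¬ₘ(f r : B) ⊕ₘ (f s : B) := by
  obtain ⟨t, rfl | rfl⟩ := h
  · rw [add_comm, Radical.neg_add_oplus, radicalExtend_neg_coe, map_add, Radical.neg_add_oplus]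
  · rw [map_add, Radical.coe_add, Radical.coe_add, neg_oplus_self_oplus, neg_oplus_self_oplus,
      radicalExtend_one]

theorem radicalExtend_oplus (f : Radical A →+ Radical B)
    (hA : ∀ r s : Radical A, ∃ t, r = s + t ∨ s = r + t) (x y : A) :
    radicalExtend f (x ⊕ₘ y) = radicalExtend f x ⊕ₘ radicalExtend f y := by
  obtain ⟨r, rfl | rfl⟩ := Radical.exists_eq_or_eq_neg x <;>
    obtain ⟨s, rfl | rfl⟩ := Radical.exists_eq_or_eq_neg y
  · rw [← Radical.coe_add, radicalExtend_coe, radicalExtend_coe, radicalExtend_coe, map_add,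
      Radical.coe_add]
  · rw [oplus_comm, radicalExtend_neg_oplus f (hA s r), oplus_comm, radicalExtend_coe,
      radicalExtend_neg_coe]
  · rw [radicalExtend_neg_oplus f (hA r s), radicalExtend_coe, radicalExtend_neg_coe]
  · rw [Radical.neg_oplus_neg, radicalExtend_one, radicalExtend_neg_coe, radicalExtend_neg_coe,
      Radical.neg_oplus_neg]

/-- A perfect MV-algebra whose radical is totally ordered by divisibility is determined up to
isomorphism by its radical. -/
noncomputable def equivOfRadicalEquiv (e : Radical A ≃+ Radical B)
    (hA : ∀ r s : Radical A, ∃ t, r = s + t ∨ s = r + t) : A ≃[mvLanguage] B where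
  toFun := radicalExtend e
  invFun := radicalExtend e.symm
  left_inv := leftInverse_radicalExtend e.left_inv
  right_inv := leftInverse_radicalExtend e.right_inv
  map_fun' := by
    rintro _ (_ | _ | _ | _) a
    · exact radicalExtend_zero (e : Radical A →+ Radical B)
    · exact radicalExtend_one (e : Radical A →+ Radical B)
    · exact radicalExtend_neg e (a 0)
    · exact radicalExtend_oplus (e : Radical A →+ Radical B) hA (a 0) (a 1)
  map_rel' := by rintro _ ⟨⟩

end Extend

end Radical

end MVAlgebra

namespace MVDelta

open MVAlgebra

variable {G : Type*} [AddCommGroup G] [LinearOrder G]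

theorem fst_eq_zero_or_eq_one (x : MVDelta G) :
    (ofLex x.1).1 = 0 ∨ (ofLex x.1).1 = 1 := by
  have h0 : 0 ≤ (ofLex x.1).1 := (Prod.Lex.le_iff'.1 x.2.1).1
  have h1 : (ofLex x.1).1 ≤ 1 := (Prod.Lex.le_iff'.1 x.2.2).1
  omega

variable [IsOrderedAddMonoid G]

theorem coe_oplus (x y : MVDelta G) : (oplus x y).1 = (x.1 + y.1) ⊓ toLex (1, 0) := rfl

theorem coe_neg (x : MVDelta G) : (neg x).1 = toLex (1, 0) - x.1 := rfl

theorem isInfinitesimal_iff {x : MVDelta G} : IsInfinitesimal x ↔ (ofLex x.1).1 = 0 := by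
  have h : IsInfinitesimal x ↔ toLex (1, 0) ≤ toLex (1, 0) - x.1 + (toLex (1, 0) - x.1) := by
    rw [← inf_eq_right]
    exact Subtype.ext_iff
  rw [h, Prod.Lex.le_iff]
  constructor
  · rcases fst_eq_zero_or_eq_one x with hx | hx <;> simp [hx]
  · intro hx
    simp [hx]

theorem coe_eq_of_isInfinitesimal {x : MVDelta G} (hx : IsInfinitesimal x) :
    x.1 = toLex (0, (ofLex x.1).2) :=
  congrArg toLex (Prod.ext (isInfinitesimal_iff.1 hx) rfl)

theorem snd_nonneg_of_isInfinitesimal {x : MVDelta G} (hx : IsInfinitesimal x) :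
    0 ≤ (ofLex x.1).2 :=
  (Prod.Lex.le_iff'.1 x.2.1).2 (isInfinitesimal_iff.1 hx).symm

theorem coe_oplus_of_isInfinitesimal {x y : MVDelta G} (hx : IsInfinitesimal x)
    (hy : IsInfinitesimal y) : (oplus x y).1 = x.1 + y.1 := by
  rw [coe_oplus, inf_eq_left, Prod.Lex.le_iff]
  left
  simp [isInfinitesimal_iff.1 hx, isInfinitesimal_iff.1 hy]

instance : IsPerfect (MVDelta G) where
  zero_ne_one h := zero_ne_one (congrArg (fun x : MVDelta G => (ofLex x.1).1) h)
  isInfinitesimal_or_neg x := by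
    simp only [isInfinitesimal_iff, coe_neg]
    rcases fst_eq_zero_or_eq_one x with hx | hx <;> simp [hx]
  isInfinitesimal_oplus hx hy := by
    rw [isInfinitesimal_iff, coe_oplus_of_isInfinitesimal hx hy]
    simp [isInfinitesimal_iff.1 hx, isInfinitesimal_iff.1 hy]

variable (G) in
/-- The radical of `Δ(G)` is `{0} × G⁺`. -/
def radicalEquiv : Radical (MVDelta G) ≃+ {g : G // 0 ≤ g} where
  toFun x := ⟨(ofLex x.1.1).2, snd_nonneg_of_isInfinitesimal x.2⟩
  invFun g := ⟨⟨toLex (0, g), Prod.Lex.toLex_le_toLex.2 (.inr ⟨rfl, g.2⟩),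
    Prod.Lex.toLex_le_toLex.2 (.inl Int.zero_lt_one)⟩, isInfinitesimal_iff.2 rfl⟩
  left_inv x := Radical.ext (Subtype.ext (coe_eq_of_isInfinitesimal x.2).symm)
  right_inv _ := rfl
  map_add' x y := Subtype.ext <|
    congrArg (fun p => (ofLex p).2) (coe_oplus_of_isInfinitesimal x.2 y.2)

end MVDelta

/-- Terms in the language of MV-algebras with variables `x₀, …, xₙ₋₁`. -/
abbrev MVTerm (n : ℕ) : Type :=
  mvLanguage.Term (Fin n)

namespace MVTerm

variable {n : ℕ}

/-- The constant symbol `0`, as a term. -/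
def zero : MVTerm n := Language.Constants.term (MVFunc.zero : mvLanguage.Functions 0)

/-- The constant symbol `1`, as a term. -/
def one : MVTerm n := Language.Constants.term (MVFunc.one : mvLanguage.Functions 0)

/-- The term `¬t`. -/
def neg (t : MVTerm n) : MVTerm n :=
  Language.Functions.apply₁ (MVFunc.neg : mvLanguage.Functions 1) t

/-- The term `s ⊕ t`. -/
def oplus (s t : MVTerm n) : MVTerm n :=
  Language.Functions.apply₂ (MVFunc.oplus : mvLanguage.Functions 2) s t

/-- The term `t ⊕ ⋯ ⊕ t` with `k` summands. -/
def nsmul : ℕ → MVTerm n → MVTerm n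
  | 0, _ => zero
  | k + 1, t => oplus (nsmul k t) t

/-- The formula `¬t ⊕ ¬t = 1`, expressing `MVAlgebra.IsInfinitesimal`. -/
def infinitesimal (t : MVTerm n) : GeomFormula.{0, 0, 0} mvLanguage n :=
  .equal (oplus (neg t) (neg t)) one

/-- The sequent `⊤ ⊢ s = t`. -/
def identity (s t : MVTerm n) : GeomSequent.{0, 0, 0} mvLanguage :=
  ⟨n, .verum, .equal s t⟩

end MVTerm

/-- The index set of the axioms of `perfQTheory`. -/
inductive PerfQAxiom : Type
  | oplus_assoc
  | oplus_comm
  | oplus_zero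
  | neg_zero
  | oplus_one
  | neg_neg
  | lukasiewicz
  | zero_ne_one
  | infinitesimal_or_neg
  | infinitesimal_oplus
  | locally_cyclic

open MVTerm in
/-- The axioms of `perfQTheory`: those of MV-algebras, those making an MV-algebra perfect, and
local cyclicity of the radical. -/
def PerfQAxiom.sequent : PerfQAxiom → GeomSequent.{0, 0, 0} mvLanguage
  | oplus_assoc => identity (n := 3) (oplus (oplus (.var 0) (.var 1)) (.var 2))
      (oplus (.var 0) (oplus (.var 1) (.var 2)))
  | oplus_comm => identity (n := 2) (oplus (.var 0) (.var 1)) (oplus (.var 1) (.var 0))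
  | oplus_zero => identity (n := 1) (oplus (.var 0) zero) (.var 0)
  | neg_zero => identity (n := 0) (neg zero) one
  | oplus_one => identity (n := 1) (oplus (.var 0) one) one
  | neg_neg => identity (n := 1) (neg (neg (.var 0))) (.var 0)
  | lukasiewicz => identity (n := 2) (oplus (neg (oplus (neg (.var 0)) (.var 1))) (.var 1))
      (oplus (neg (oplus (neg (.var 1)) (.var 0))) (.var 0))
  | zero_ne_one => ⟨0, .equal zero one, .iOr Empty.elim⟩
  | infinitesimal_or_neg => ⟨1, .verum, .iOr fun b : Bool =>
      infinitesimal (if b then .var 0 else neg (.var 0))⟩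
  | infinitesimal_oplus => ⟨2, .and (infinitesimal (.var 0)) (infinitesimal (.var 1)),
      infinitesimal (oplus (.var 0) (.var 1))⟩
  | locally_cyclic => ⟨2, .and (infinitesimal (.var 0)) (infinitesimal (.var 1)),
      .ex (.and (infinitesimal (.var 2)) (.iOr fun k : ℕ × ℕ =>
        .and (.equal (.var 0) (nsmul k.1 (.var 2))) (.equal (.var 1) (nsmul k.2 (.var 2)))))⟩

/-- The geometric theory of `Perf^ℚ`. -/
def perfQTheory : GeomTheory.{0, 0, 0} mvLanguage where
  Index := PerfQAxiom
  ax := PerfQAxiom.sequent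

namespace MVTerm

variable {n : ℕ} {M : Type*} [mvLanguage.Structure M] (v : Fin n → M)

@[simp] theorem realize_zero :
    Language.Term.realize v (zero : MVTerm n) =
      Language.Structure.funMap (L := mvLanguage) MVFunc.zero ![] :=
  Language.Term.realize_constants

@[simp] theorem realize_one :
    Language.Term.realize v (one : MVTerm n) =
      Language.Structure.funMap (L := mvLanguage) MVFunc.one ![] :=
  Language.Term.realize_constants

@[simp] theorem realize_neg (t : MVTerm n) :
    (neg t).realize v = Language.Structure.funMap (L := mvLanguage) MVFunc.neg ![t.realize v] :=
  Language.Term.realize_functions_apply₁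

@[simp] theorem realize_oplus (s t : MVTerm n) :
    (oplus s t).realize v =
      Language.Structure.funMap (L := mvLanguage) MVFunc.oplus ![s.realize v, t.realize v] :=
  Language.Term.realize_functions_apply₂

theorem holds_identity {s t : MVTerm n} :
    (identity s t).Holds M ↔ ∀ v : Fin n → M, s.realize v = t.realize v :=
  forall_congr' fun _ => true_imp_iff

end MVTerm

namespace MVAlgebra

open MVTerm in
/-- The MV-algebra operations interpreting the symbols in a model of `perfQTheory`. -/
@[reducible] def ofIsModel {M : Type*} [mvLanguage.Structure M] (h : perfQTheory.IsModel M) :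
    MVAlgebra M where
  oplus x y := Language.Structure.funMap (L := mvLanguage) MVFunc.oplus ![x, y]
  neg x := Language.Structure.funMap (L := mvLanguage) MVFunc.neg ![x]
  zero := Language.Structure.funMap (L := mvLanguage) MVFunc.zero ![]
  one := Language.Structure.funMap (L := mvLanguage) MVFunc.one ![]
  oplus_assoc x y z := by simpa using holds_identity.1 (h .oplus_assoc) ![x, y, z]
  oplus_comm x y := by simpa using holds_identity.1 (h .oplus_comm) ![x, y]
  oplus_zero x := by simpa using holds_identity.1 (h .oplus_zero) ![x]
  neg_zero := by simpa using holds_identity.1 (h .neg_zero) ![]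
  oplus_one x := by simpa using holds_identity.1 (h .oplus_one) ![x]
  neg_neg x := by simpa using holds_identity.1 (h .neg_neg) ![x]
  lukasiewicz x y := by simpa using holds_identity.1 (h .lukasiewicz) ![x, y]

theorem exists_eq_instStructure_of_isModel {M : Type*} [S : mvLanguage.Structure M]
    (h : perfQTheory.IsModel M) : ∃ A : MVAlgebra M, S = @instStructure M A := by
  refine ⟨ofIsModel h, Language.Structure.ext ?_ ?_⟩
  · funext n f a
    cases f <;> exact congrArg _ (by ext i; fin_cases i <;> rfl)
  · funext n r
    exact nomatch r

section Realize

variable {A : Type*} [MVAlgebra A]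

theorem realize_nsmul [IsPerfect A] {n : ℕ} {t : MVTerm n} {v : Fin n → A} {r : Radical A}
    (h : t.realize v = r) (k : ℕ) : (t.nsmul k).realize v = (k • r : Radical A) := by
  induction k with
  | zero => rw [zero_nsmul]; exact MVTerm.realize_zero v
  | succ k ih =>
    rw [succ_nsmul, Radical.coe_add, ← ih, ← h]
    exact MVTerm.realize_oplus v _ _

theorem isPerfect_of_isModel (h : perfQTheory.IsModel A) : IsPerfect A where
  zero_ne_one h01 := let ⟨i, _⟩ := h .zero_ne_one ![] h01; i.elim
  isInfinitesimal_or_neg x := by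
    obtain ⟨_ | _, hx⟩ := h .infinitesimal_or_neg ![x] trivial
    · exact .inr hx
    · exact .inl hx
  isInfinitesimal_oplus {x y} hx hy := h .infinitesimal_oplus ![x, y] ⟨hx, hy⟩

theorem isLocallyCyclic_radical_of_isModel [IsPerfect A] (h : perfQTheory.IsModel A) :
    IsLocallyCyclic (Radical A) := by
  intro x y
  obtain ⟨z, hz, k, hxz, hyz⟩ := h .locally_cyclic ![x, y] ⟨x.2, y.2⟩
  refine ⟨⟨z, hz⟩, k.1, k.2, Radical.ext ?_, Radical.ext ?_⟩
  · exact hxz.trans (realize_nsmul rfl k.1)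
  · exact hyz.trans (realize_nsmul rfl k.2)

theorem isModel_perfQTheory [IsPerfect A] (h : IsLocallyCyclic (Radical A)) :
    perfQTheory.IsModel A
  | .oplus_assoc => fun _ _ => oplus_assoc _ _ _
  | .oplus_comm => fun _ _ => oplus_comm _ _
  | .oplus_zero => fun _ _ => oplus_zero _
  | .neg_zero => fun _ _ => neg_zero
  | .oplus_one => fun _ _ => oplus_one _
  | .neg_neg => fun _ _ => neg_neg _
  | .lukasiewicz => fun _ _ => lukasiewicz _ _
  | .zero_ne_one => fun _ h => (IsPerfect.zero_ne_one h).elim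
  | .infinitesimal_or_neg => fun _ _ => (IsPerfect.isInfinitesimal_or_neg _).elim
      (fun hx => ⟨true, hx⟩) fun hx => ⟨false, hx⟩
  | .infinitesimal_oplus => fun _ ha => IsPerfect.isInfinitesimal_oplus ha.1 ha.2
  | .locally_cyclic => fun (a : Fin 2 → A) ha => by
    obtain ⟨z, m, n, hm, hn⟩ := h ⟨a 0, ha.1⟩ ⟨a 1, ha.2⟩
    exact ⟨z, z.2, (m, n), (congrArg Subtype.val hm).trans (Eq.symm (realize_nsmul rfl m)),
      (congrArg Subtype.val hn).trans (Eq.symm (realize_nsmul rfl n))⟩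

end Realize

end MVAlgebra

theorem mainTheorem9 :
    IsGeometricClass.{0, 0, 0, u} mvLanguage (fun (M : Type u) _ => IsPerfQ M) := by
  refine ⟨perfQTheory, fun M S => ⟨fun h => ?_, ?_⟩⟩
  · obtain ⟨A, rfl⟩ := MVAlgebra.exists_eq_instStructure_of_isModel h
    have perfect := MVAlgebra.isPerfect_of_isModel h
    have cyclic := MVAlgebra.isLocallyCyclic_radical_of_isModel h
    obtain ⟨G, ⟨e⟩⟩ := cyclic.exists_addEquiv_nonneg_addSubgroup_rat
    exact ⟨G, ⟨MVAlgebra.equivOfRadicalEquiv (e.trans (MVDelta.radicalEquiv G).symm)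
      cyclic.exists_eq_add_or⟩⟩
  · rintro ⟨G, ⟨e⟩⟩
    have cyclic : IsLocallyCyclic (MVAlgebra.Radical (MVDelta G)) :=
      (isLocallyCyclic_nonneg_addSubgroup_rat G).of_surjective
        (MVDelta.radicalEquiv G).symm (MVDelta.radicalEquiv G).symm.surjective
    exact (MVAlgebra.isModel_perfQTheory cyclic).of_equiv e
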